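/- Let $n\in\mathbb N$, let $(S,\mathcal S)$ and $(T_i,\mathcal T_i)$, $i=1,\dots,n$, be measurable spaces such that each $\mathcal T_i$ is universally complete (it contains every set that belongs to the $\mu$-completion of $\mathcal T_i$ for every probability measure $\mu$ on $T_i$), and let each $A_i$ be a compact metrizable space with its Borel $\sigma$-algebra. Put $T=\prod_i T_i$, $T_{-i}=\prod_{j\ne i}T_j$, $A=\prod_i A_i$, with product $\sigma$-algebras. Let $G$ be the game with measurable payoffs $u_i:A\times S\times T\to\mathbb R$ and belief maps $\eta_i$, which are probability kernels from $T_i$ to $S\times T_{-i}$. Assume that for each $i$ - there is a measurable $\overline u_i:T_i\to[0,\infty)$ (fixed from now on) with $|u_i(a,s,t)|\le\overline u_i(t_i)$ for all $a,s,t$; - $a_i\mapsto u_i(a_i,a_{-i},s,t)$ is upper semicontinuous on $A_i$ for all $a_{-i},s,t$. A behavioral strategy of player $i$ is a probability kernel $\gamma_i$ from $T_i$ to $A_i$; $\mathcal R_i$ is the set of these and $\mathcal R=\prod_i\mathcal R_i$. For $\gamma\in\mathcal R$ let $$V_i(\gamma;s,t)=\int_{A_1}\!\cdots\!\int_{A_n}u_i(a,s,t)\,\gamma_1(t_1,da_1)\cdots\gamma_n(t_n,da_n),\qquad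 U_i(\gamma;t_i)=\int V_i(\gamma;s,t)\,\eta_i(t_i,d(s,t_{-i})).$$ $\mathsf{BE}$ is the set of $\gamma^*\in\mathcal R$ with $U_i(\gamma_i^*,\gamma_{-i}^*;t_i)\ge U_i(\gamma_i,\gamma_{-i}^*;t_i)$ for all $i$, **all** $t_i\in T_i$ and all $\gamma_i\in\mathcal R_i$. Let $\mathcal M$ be the set of product probability measures $\nu=\nu_0\otimes\nu_1\otimes\cdots\otimes\nu_n$ on $S\times T$ such that, for every $i$, $\eta_i(t_i,\cdot)\ll\nu_0\otimes\nu_{-i}$ for all $t_i\in T_i$, where $\nu_{-i}=\bigotimes_{j\ne i}\nu_j$, and $\int\overline u_i\,d\nu_i<\infty$. For $\nu\in\mathcal M$ let $f_{\nu,i}:T_i\times S\times T_{-i}\to[0,\infty)$ be any version of the Radon–Nikodym derivative of $\nu_i\otimes\eta_i$ with respect to $\nu_i\otimes(\nu_0\otimes\nu_{-i})$, and put $$\widetilde u_i(a,s,t)=u_i(a,s,t)\,f_{\nu,i}(t_i,s,t_{-i}),$$ $$\widetilde U_i(\gamma;\nu)=\int\Big(\int_{A_1}\!\cdots\!\int_{A_n}\widetilde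 u_i(a,s,t)\,\gamma_1(t_1,da_1)\cdots\gamma_n(t_n,da_n)\Big)\,\nu(d(s,t)).$$ $\mathsf{BNE}_\nu$ is the set of Bayesian Nash equilibria of the common-prior game with prior $\nu$ and payoffs $\widetilde u_i$: the $\gamma^*\in\mathcal R$ with $\widetilde U_i(\gamma_i^*,\gamma_{-i}^*;\nu)\ge\widetilde U_i(\gamma_i,\gamma_{-i}^*;\nu)$ for all $i$ and all $\gamma_i\in\mathcal R_i$. Write $\gamma\sim_\nu\gamma'$ if, for each $i$, $\gamma_i(t_i,\cdot)=\gamma_i'(t_i,\cdot)$ for $\nu_i$-almost every $t_i$. **Proposition.** For each $\nu\in\mathcal M$, $$\mathsf{BNE}_\nu=\{\gamma\in\mathcal R:\ \gamma\sim_\nu\gamma'\text{ for some }\gamma'\in\mathsf{BE}\}.$$ -/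

import Mathlib

open MeasureTheory ProbabilityTheory
open scoped NNReal ENNReal

/-- The σ-algebra of `X` is universally complete: it contains every set that belongs to the
`μ`-completion of the σ-algebra for every probability measure `μ`. -/
def IsUniversallyComplete (X : Type*) [MeasurableSpace X] : Prop :=
  ∀ E : Set X, (∀ μ : Measure X, IsProbabilityMeasure μ → NullMeasurableSet E μ) →
    MeasurableSet E

/-- The set `T_{-i}` of type profiles of the players other than `i`, with the product σ-algebra. -/
abbrev OtherTypes {n : ℕ} (T : Fin n → Type*) (i : Fin n) : Type _ :=
  ∀ j : {j : Fin n // j ≠ i}, T j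

/-- The profile `t = (t_i, t_{-i})`. -/
def joinTypes {n : ℕ} {T : Fin n → Type*} (i : Fin n) (ti : T i) (tmi : OtherTypes T i) :
    ∀ j, T j :=
  (Equiv.piSplitAt i T).symm (ti, tmi)

/-- An incomplete information game with `n` players, payoff types `S`, type sets `T i` and action
sets `A i`: measurable payoff functions `u i` and belief maps `η i` (probability kernels from `T i`
to `S × T_{-i}`). For second countable action spaces with their Borel σ-algebras, the product
σ-algebra on `∀ j, A j` used here is the Borel σ-algebra of the product. -/
structure IncompleteInfoGame {n : ℕ} (S : Type*) (T A : Fin n → Type*) [MeasurableSpace S]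
    [∀ i, MeasurableSpace (T i)] [∀ i, MeasurableSpace (A i)] where
  /-- payoff functions -/
  u : Fin n → (∀ j, A j) → S → (∀ j, T j) → ℝ
  measurable_u : ∀ i, Measurable fun p : (∀ j, A j) × S × (∀ j, T j) => u i p.1 p.2.1 p.2.2
  /-- belief maps -/
  η : ∀ i, Kernel (T i) (S × OtherTypes T i)
  markov_η : ∀ i, IsMarkovKernel (η i)

/-- Behavioral strategies: probability kernels from `Ti` to `Ai`. -/
abbrev BehavioralStrategy (Ti Ai : Type*) [MeasurableSpace Ti] [MeasurableSpace Ai] : Type _ :=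
  {γ : Kernel Ti Ai // IsMarkovKernel γ}

/-- Profiles of behavioral strategies. -/
abbrev StrategyProfile {n : ℕ} (T A : Fin n → Type*) [∀ i, MeasurableSpace (T i)]
    [∀ i, MeasurableSpace (A i)] : Type _ :=
  ∀ i, BehavioralStrategy (T i) (A i)

/-- Product probability measures `ν = ν_0 ⊗ ν_1 ⊗ ⋯ ⊗ ν_n` on `S × T`, given by their factors
(which are the marginals of `ν` and hence determined by it). -/
structure ProductProb {n : ℕ} (S : Type*) (T : Fin n → Type*) [MeasurableSpace S]
    [∀ i, MeasurableSpace (T i)] where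
  /-- the factor on `S` -/
  nature : Measure S
  /-- the factor on `T i` -/
  type : ∀ i, Measure (T i)
  prob_nature : IsProbabilityMeasure nature
  prob_type : ∀ i, IsProbabilityMeasure (type i)

namespace ProductProb

variable {n : ℕ} {S : Type*} {T : Fin n → Type*} [MeasurableSpace S] [∀ i, MeasurableSpace (T i)]

/-- The measure `ν` on `S × T`. -/
noncomputable def measure (ν : ProductProb S T) : Measure (S × (∀ j, T j)) :=
  haveI := ν.prob_nature
  haveI := ν.prob_type
  ν.nature.prod (Measure.pi ν.type)

/-- The measure `ν_0 ⊗ ν_{-i}` on `S × T_{-i}`. -/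
noncomputable def others (ν : ProductProb S T) (i : Fin n) : Measure (S × OtherTypes T i) :=
  haveI := ν.prob_nature
  haveI := ν.prob_type
  ν.nature.prod (Measure.pi fun j : {j : Fin n // j ≠ i} => ν.type j)

end ProductProb

/-- `γ ∼_ν γ'`: for each `i`, `γ_i(t_i, ·) = γ'_i(t_i, ·)` for `ν_i`-almost all `t_i`. -/
def StrategyEquiv {n : ℕ} {S : Type*} {T A : Fin n → Type*} [MeasurableSpace S]
    [∀ i, MeasurableSpace (T i)] [∀ i, MeasurableSpace (A i)] (ν : ProductProb S T)
    (γ γ' : StrategyProfile T A) : Prop :=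
  ∀ i, ∀ᵐ ti ∂(ν.type i), (γ i).1 ti = (γ' i).1 ti

/-- The payoff `∫_{A_1} ⋯ ∫_{A_n} v(a, s, t) γ_1(t_1, da_1) ⋯ γ_n(t_n, da_n)`. -/
noncomputable def mixedPayoff {n : ℕ} {S : Type*} {T A : Fin n → Type*}
    [∀ i, MeasurableSpace (T i)] [∀ i, MeasurableSpace (A i)]
    (v : (∀ j, A j) → S → (∀ j, T j) → ℝ) (γ : StrategyProfile T A) (s : S) (t : ∀ j, T j) : ℝ :=
  haveI := fun j => (γ j).2
  ∫ a, v a s t ∂(Measure.pi fun j => (γ j).1 (t j))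

namespace IncompleteInfoGame

variable {n : ℕ} {S : Type*} {T A : Fin n → Type*} [MeasurableSpace S]
  [∀ i, MeasurableSpace (T i)] [∀ i, MeasurableSpace (A i)]

/-- `|u_i(a, s, t)| ≤ ubar_i(t_i)` for measurable maps `ubar_i : T_i → [0, ∞)`. -/
def PayoffBound (G : IncompleteInfoGame S T A) (ubar : ∀ i, T i → ℝ≥0) : Prop :=
  ∀ i, Measurable (ubar i) ∧ ∀ a s t, |G.u i a s t| ≤ ubar i (t i)

/-- Each payoff function is upper semicontinuous in the player's own action. -/
def UpperSemicontinuousPayoffs [∀ i, TopologicalSpace (A i)] (G : IncompleteInfoGame S T A) :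
    Prop :=
  ∀ i a s t, UpperSemicontinuous fun ai : A i => G.u i (Function.update a i ai) s t

/-- The expected payoff `U_i(γ; t_i) = ∫ V_i(γ; s, t) η_i(t_i, d(s, t_{-i}))`. -/
noncomputable def expectedPayoff (G : IncompleteInfoGame S T A) (i : Fin n)
    (γ : StrategyProfile T A) (ti : T i) : ℝ :=
  ∫ p, mixedPayoff (G.u i) γ p.1 (joinTypes i ti p.2) ∂(G.η i ti)

/-- The set `BE` of Bayesian equilibria: optimality against every deviation at every type. -/
def BE (G : IncompleteInfoGame S T A) : Set (StrategyProfile T A) :=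
  {γ | ∀ i, ∀ ti : T i, ∀ δ : BehavioralStrategy (T i) (A i),
    G.expectedPayoff i (Function.update γ i δ) ti ≤ G.expectedPayoff i γ ti}

/-- The set `M` of product probability measures that dominate the belief maps,
`η_i(t_i, ·) ≪ ν_0 ⊗ ν_{-i}` for all `i` and `t_i`, and integrate the bounds `ubar i`. -/
def M (G : IncompleteInfoGame S T A) (ubar : ∀ i, T i → ℝ≥0) : Set (ProductProb S T) :=
  {ν | (∀ i, ∀ ti : T i, G.η i ti ≪ ν.others i) ∧
    ∀ i, ∫⁻ ti, (ubar i ti : ℝ≥0∞) ∂(ν.type i) < ∞}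

/-- `f i` is a version of the Radon-Nikodym derivative of `ν_i ⊗ η_i` with respect to
`ν_i ⊗ (ν_0 ⊗ ν_{-i})`, for each `i`. -/
def IsBeliefDensity (G : IncompleteInfoGame S T A) (ν : ProductProb S T)
    (f : ∀ i, T i × S × OtherTypes T i → ℝ≥0) : Prop :=
  ∀ i, Measurable (f i) ∧
    (ν.type i).compProd (G.η i) =
      ((ν.type i).prod (ν.others i)).withDensity fun x => (f i x : ℝ≥0∞)

/-- The density-weighted payoff `ũ_i(a, s, t) = u_i(a, s, t) f_i(t_i, s, t_{-i})`. -/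
def weightedPayoff (G : IncompleteInfoGame S T A) (f : ∀ i, T i × S × OtherTypes T i → ℝ≥0)
    (i : Fin n) (a : ∀ j, A j) (s : S) (t : ∀ j, T j) : ℝ :=
  G.u i a s t * f i (t i, s, fun j => t j)

/-- The ex ante expected payoff of player `i` in the game with common prior `ν` and
density-weighted payoffs. -/
noncomputable def exAntePayoff (G : IncompleteInfoGame S T A) (ν : ProductProb S T)
    (f : ∀ i, T i × S × OtherTypes T i → ℝ≥0) (i : Fin n) (γ : StrategyProfile T A) : ℝ :=
  ∫ p, mixedPayoff (G.weightedPayoff f i) γ p.1 p.2 ∂ν.measure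

/-- The set `BNE_ν` of Bayesian Nash equilibria of the game with common prior `ν` and
density-weighted payoffs. -/
def BNE (G : IncompleteInfoGame S T A) (ν : ProductProb S T)
    (f : ∀ i, T i × S × OtherTypes T i → ℝ≥0) : Set (StrategyProfile T A) :=
  {γ | ∀ i, ∀ δ : BehavioralStrategy (T i) (A i),
    G.exAntePayoff ν f i (Function.update γ i δ) ≤ G.exAntePayoff ν f i γ}

/-- The profiles that are `ν`-equivalent to some Bayesian equilibrium. -/
def BEClosure (G : IncompleteInfoGame S T A) (ν : ProductProb S T) : Set (StrategyProfile T A) :=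
  {γ | ∃ γ' ∈ G.BE, StrategyEquiv ν γ γ'}

end IncompleteInfoGame

/-!
The density `f i` turns integration against `ν` into integration against `ν_i ⊗ η_i`, so the ex ante
payoff of player `i` is the `ν_i`-mean of the interim payoffs. Given a strategy that is a best reply
at every type, an ex ante optimal strategy is therefore the same as one that is a best reply at
almost every type. Such strategies can be repaired on the exceptional null sets by switching to best
replies there; since `η_i(t_i, ·) ≪ ν_0 ⊗ ν_{-i}`, no type of any other player notices the change.

A best reply at every type exists by a measurable maximum theorem. The value function and a
canonical maximizer are suprema over measurable sets, so their level sets are projections of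
measurable sets along a standard Borel space. Such projections are preimages of analytic sets, which
are universally measurable by capacitability, and universal completeness makes them measurable.
-/

section AnalyticSets

open Set Filter Topology Metric

theorem exists_lt_measure_image_inter_setOf_le {X Y : Type*} [MeasurableSpace Y] (μ : Measure Y)
    (g : X → Y) (p : X → ℕ) {s : Set X} {r : ℝ≥0∞} (hr : r < μ (g '' s)) :
    ∃ m, r < μ (g '' (s ∩ {x | p x ≤ m})) := by
  have hmono : Monotone fun m => g '' (s ∩ {x | p x ≤ m}) := fun _ _ hab =>
    image_mono (inter_subset_inter_right _ fun _ hx => le_trans hx hab)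
  have hunion : g '' s = ⋃ m, g '' (s ∩ {x | p x ≤ m}) := by
    have hcover : ⋃ m, {x | p x ≤ m} = univ := iUnion_eq_univ_iff.2 fun x => ⟨p x, le_refl (p x)⟩
    rw [← image_iUnion, ← inter_iUnion, hcover, inter_univ]
  rw [hunion, hmono.directed_le.measure_iUnion] at hr
  exact lt_iSup_iff.1 hr

theorem exists_forall_lt_measure_image_setOf_forall_lt_le {Y : Type*} [MeasurableSpace Y]
    (μ : Measure Y) (g : (ℕ → ℕ) → Y) {r : ℝ≥0∞} (hr : r < μ (range g)) :
    ∃ c : ℕ → ℕ, ∀ k, r < μ (g '' {x | ∀ i < k, x i ≤ c i}) := by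
  choose m hm using fun (k : ℕ) (s : {s : Set (ℕ → ℕ) // r < μ (g '' s)}) =>
    exists_lt_measure_image_inter_setOf_le μ g (· k) s.2
  let s : ℕ → {s : Set (ℕ → ℕ) // r < μ (g '' s)} := fun k =>
    Nat.rec ⟨univ, by rwa [image_univ]⟩ (fun k s => ⟨s.1 ∩ {x | x k ≤ m k s}, hm k s⟩) k
  have hs (k : ℕ) : (s k).1 = {x | ∀ i < k, x i ≤ m i (s i)} := by
    induction k with
    | zero => simp [s]
    | succ k ih =>
      change (s k).1 ∩ {x | x k ≤ m k (s k)} = _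
      ext x
      simp only [ih, mem_inter_iff, mem_ofPred_eq, Nat.forall_lt_succ_right]
  exact ⟨fun k => m k (s k), fun k => hs k ▸ (s k).2⟩

theorem exists_setOf_forall_lt_le_subset_of_isOpen {c : ℕ → ℕ} {V : Set (ℕ → ℕ)} (hV : IsOpen V)
    (hcV : univ.pi (fun i => Iic (c i)) ⊆ V) : ∃ k, {x | ∀ i < k, x i ≤ c i} ⊆ V := by
  let : MetricSpace (ℕ → ℕ) := PiNat.metricSpaceNatNat
  have hK : IsCompact (univ.pi fun i => Iic (c i)) :=
    isCompact_univ_pi fun i => (finite_Iic (c i)).isCompact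
  obtain ⟨δ, hδ, hδV⟩ := hK.exists_thickening_subset_open hV hcV
  obtain ⟨k, hk⟩ := exists_pow_lt_of_lt_one hδ one_half_lt_one
  refine ⟨k, fun x hx => hδV (mem_thickening_iff.2 ⟨fun i => min (x i) (c i), ?_, ?_⟩)⟩
  · exact fun i _ => mem_Iic.2 (min_le_right _ _)
  · have hcyl : x ∈ PiNat.cylinder (fun i => min (x i) (c i)) k :=
      PiNat.mem_cylinder_iff.2 fun i hi => (min_eq_left (hx i hi)).symm
    exact (PiNat.mem_cylinder_iff_dist_le.1 hcyl).trans_lt hk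

/-- Bounding the coordinates of the Baire space one after the other keeps the measure of the image
above `r`, and an open set around the image of the resulting compact set already contains the image
of one of these stages: this is how Choquet's capacitability theorem is proved. -/
theorem exists_isCompact_le_measure_image {Y : Type*} [TopologicalSpace Y] [MeasurableSpace Y]
    (μ : Measure Y) [μ.OuterRegular] {g : (ℕ → ℕ) → Y} (hg : Continuous g) {r : ℝ≥0∞}
    (hr : r < μ (range g)) : ∃ K : Set (ℕ → ℕ), IsCompact K ∧ r ≤ μ (g '' K) := by
  obtain ⟨c, hc⟩ := exists_forall_lt_measure_image_setOf_forall_lt_le μ g hr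
  refine ⟨univ.pi fun i => Iic (c i),
    isCompact_univ_pi fun i => (finite_Iic (c i)).isCompact, ?_⟩
  rw [measure_eq_iInf_isOpen]
  refine le_iInf₂ fun U hKU => le_iInf fun hU => ?_
  obtain ⟨k, hk⟩ :=
    exists_setOf_forall_lt_le_subset_of_isOpen (hU.preimage hg) (image_subset_iff.1 hKU)
  exact (hc k).le.trans (measure_mono (image_subset_iff.2 hk))

theorem nullMeasurableSet_of_analyticSet {Y : Type*} [TopologicalSpace Y] [T2Space Y]
    [MeasurableSpace Y] [OpensMeasurableSpace Y] (μ : Measure Y) [IsFiniteMeasure μ]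
    [μ.OuterRegular] {s : Set Y} (hs : AnalyticSet s) : NullMeasurableSet s μ := by
  rw [AnalyticSet] at hs
  obtain rfl | ⟨g, hg, rfl⟩ := hs
  · exact nullMeasurableSet_empty
  obtain hzero | hpos := eq_zero_or_pos (μ (range g))
  · exact NullMeasurableSet.of_null hzero
  obtain ⟨r, -, hr, hlim⟩ := exists_seq_strictMono_tendsto' hpos
  choose K hK hrK using fun k => exists_isCompact_le_measure_image μ hg (hr k).2
  have hmeas : MeasurableSet (⋃ k, g '' K k) :=
    MeasurableSet.iUnion fun k => ((hK k).image hg).measurableSet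
  have hle : μ (range g) ≤ μ (⋃ k, g '' K k) :=
    le_of_tendsto' hlim fun k => (hrK k).trans (measure_mono (subset_iUnion (fun k => g '' K k) k))
  have hsub : ⋃ k, g '' K k ⊆ range g := iUnion_subset fun k => image_subset_range _ _
  exact hmeas.nullMeasurableSet.congr
    (ae_eq_of_subset_of_measure_ge hsub hle hmeas.nullMeasurableSet (measure_ne_top μ _))

end AnalyticSets

section MeasurableSelection

open Set Filter Topology

/-- The countably many rectangles that generate a given measurable set only see the second factor
through countably many measurable sets, hence through a map to the Cantor space. -/
theorem exists_eq_preimage_prodMap_of_measurableSet {X T : Type*} [MeasurableSpace X]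
    [MeasurableSpace T] {E : Set (X × T)} (hE : MeasurableSet E) :
    ∃ (g : T → ℕ → Bool) (E' : Set (X × (ℕ → Bool))), Measurable g ∧ MeasurableSet E' ∧
      E = Prod.map id g ⁻¹' E' := by
  classical
  rw [← generateFrom_prod] at hE
  induction E, hE using MeasurableSpace.generateFrom_induction with
  | hC s hs _ =>
    obtain ⟨a, ha, b, hb, rfl⟩ := hs
    refine ⟨fun t _ => decide (t ∈ b), a ×ˢ {x | x 0 = true}, ?_, ?_, ?_⟩
    · refine measurable_pi_iff.2 fun _ => measurable_to_bool ?_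
      simpa [preimage] using hb
    · exact MeasurableSet.prod ha (measurableSet_eq_fun (measurable_pi_apply 0) measurable_const)
    · ext; simp
  | empty => exact ⟨fun _ _ => true, ∅, measurable_const, .empty, by simp⟩
  | compl s _ ih =>
    obtain ⟨g, E', hg, hE', rfl⟩ := ih
    exact ⟨g, E'ᶜ, hg, hE'.compl, rfl⟩
  | iUnion s _ ih =>
    choose g E' hg hE' hs using ih
    refine ⟨fun t k => g k.unpair.1 t k.unpair.2,
      ⋃ k, (fun p : X × (ℕ → Bool) => (p.1, fun m => p.2 (Nat.pair k m))) ⁻¹' E' k, ?_, ?_, ?_⟩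
    · exact measurable_pi_iff.2 fun k => measurable_pi_iff.1 (hg _) _
    · refine MeasurableSet.iUnion fun k => measurableSet_preimage ?_ (hE' k)
      fun_prop
    · ext p
      simp only [mem_iUnion, mem_preimage, hs, Prod.map, Nat.unpair_pair]

namespace IsUniversallyComplete

variable {T : Type*} [MeasurableSpace T]

theorem measurableSet_image_snd (hT : IsUniversallyComplete T) {X : Type*} [MeasurableSpace X]
    [StandardBorelSpace X] {E : Set (X × T)} (hE : MeasurableSet E) :
    MeasurableSet (Prod.snd '' E) := by
  refine hT _ fun μ hμ => ?_
  obtain ⟨g, E', hg, hE', rfl⟩ := exists_eq_preimage_prodMap_of_measurableSet hE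
  have himage : Prod.snd '' (Prod.map id g ⁻¹' E' : Set (X × T)) = g ⁻¹' (Prod.snd '' E') := by
    ext t
    simp
  have hnull : NullMeasurableSet (Prod.snd '' E') (μ.map g) :=
    have := Measure.isProbabilityMeasure_map (μ := μ) hg.aemeasurable
    nullMeasurableSet_of_analyticSet _ (hE'.analyticSet_image measurable_snd)
  exact himage ▸ hnull.preimage (hg.quasiMeasurePreserving μ)

theorem measurable_of_isLUB_image (hT : IsUniversallyComplete T) {X α : Type*} [MeasurableSpace X]
    [StandardBorelSpace X] [LinearOrder α] [TopologicalSpace α] [OrderTopology α]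
    [SecondCountableTopology α] [MeasurableSpace α] [BorelSpace α] {E : Set (X × T)}
    (hE : MeasurableSet E) {F : X × T → α} (hF : Measurable F) {v : T → α}
    (hv : ∀ t, IsLUB ((fun x => F (x, t)) '' {x | (x, t) ∈ E}) (v t)) : Measurable v := by
  refine measurable_of_Ioi fun c => ?_
  have hlt : MeasurableSet {p | c < F p} := measurableSet_lt measurable_const hF
  convert hT.measurableSet_image_snd (hE.inter hlt) using 1
  ext t
  simp [lt_isLUB_iff (hv t)]

/-- Among the maximizers, which form a compact set, the one with the least real coordinate is
unique; this makes the choice measurable. -/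
theorem exists_measurable_argmax_of_injective (hT : IsUniversallyComplete T) {X : Type*}
    [TopologicalSpace X] [CompactSpace X] [Nonempty X] [MeasurableSpace X] [BorelSpace X]
    {ρ : X → ℝ} (hρ : Continuous ρ) (hinj : ρ.Injective) {F : X → T → ℝ}
    (hF : Measurable fun p : X × T => F p.1 p.2) (husc : ∀ t, UpperSemicontinuous (F · t)) :
    ∃ s : T → X, Measurable s ∧ ∀ t x, F x t ≤ F (s t) t := by
  have hρ' : IsClosedEmbedding ρ := hρ.isClosedEmbedding hinj
  have : PolishSpace X := hρ'.polishSpace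
  have hmax (t : T) : ∃ x, ∀ y, F y t ≤ F x t := by
    obtain ⟨x, -, hx⟩ := ((husc t).upperSemicontinuousOn univ).exists_isMaxOn univ_nonempty
      isCompact_univ
    exact ⟨x, fun y => hx (mem_univ y)⟩
  choose m hm using hmax
  have hleast (t : T) : ∃ x, F (m t) t ≤ F x t ∧ ∀ y, F (m t) t ≤ F y t → ρ x ≤ ρ y := by
    have hclosed : IsClosed {x | F (m t) t ≤ F x t} := (husc t).isClosed_preimage _
    exact hclosed.isCompact.exists_isMinOn ⟨m t, le_refl (F (m t) t)⟩ hρ.continuousOn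
  choose s hs hsmin using hleast
  have hvalue : Measurable fun t => F (m t) t :=
    hT.measurable_of_isLUB_image .univ hF fun t =>
      IsGreatest.isLUB ⟨⟨m t, mem_univ _, rfl⟩, forall_mem_image.2 fun x _ => hm t x⟩
  have hargmax : MeasurableSet {p : X × T | F (m p.2) p.2 ≤ F p.1 p.2} :=
    measurableSet_le (hvalue.comp measurable_snd) hF
  have hcoord : Measurable fun t => -ρ (s t) :=
    hT.measurable_of_isLUB_image hargmax (hρ.measurable.comp measurable_fst).neg fun t =>
      IsGreatest.isLUB
        ⟨⟨s t, hs t, rfl⟩, forall_mem_image.2 fun x hx => neg_le_neg (hsmin t x hx)⟩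
  refine ⟨s, hρ'.measurableEmbedding.measurable_comp_iff.1 ?_, fun t x => (hm t x).trans (hs t)⟩
  exact measurable_neg_iff.1 hcoord

theorem exists_measurable_argmax (hT : IsUniversallyComplete T) {A : Type*} [TopologicalSpace A]
    [CompactSpace A] [TopologicalSpace.MetrizableSpace A] [Nonempty A] [MeasurableSpace A]
    [BorelSpace A] {F : A → T → ℝ} (hF : Measurable fun p : A × T => F p.1 p.2)
    (husc : ∀ t, UpperSemicontinuous (F · t)) :
    ∃ s : T → A, Measurable s ∧ ∀ t a, F a t ≤ F (s t) t := by
  let := TopologicalSpace.metrizableSpaceMetric A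
  obtain ⟨φ, hφ, hsurj⟩ := exists_nat_bool_continuous_surjective_of_compact A
  obtain ⟨s, hs, hmax⟩ := hT.exists_measurable_argmax_of_injective
    (continuous_subtype_val.comp cantorSetHomeomorphNatToBool.symm.continuous)
    (Subtype.val_injective.comp cantorSetHomeomorphNatToBool.symm.injective)
    (F := fun x t => F (φ x) t)
    (hF.comp ((hφ.measurable.comp measurable_fst).prodMk measurable_snd))
    (fun t => (husc t).comp hφ)
  exact ⟨φ ∘ s, hφ.measurable.comp hs, fun t => hsurj.forall.2 (hmax t)⟩

end IsUniversallyComplete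

end MeasurableSelection

section SemicontinuousIntegrals

open Filter Topology

theorem lowerSemicontinuous_lintegral {A Y : Type*} [TopologicalSpace A]
    [FirstCountableTopology A] [MeasurableSpace Y] {μ : Measure Y} {h : A → Y → ℝ≥0∞}
    (hmeas : ∀ a, AEMeasurable (h a) μ) (hlsc : ∀ᵐ y ∂μ, LowerSemicontinuous (h · y)) :
    LowerSemicontinuous fun a => ∫⁻ y, h a y ∂μ :=
  lowerSemicontinuous_iff_le_liminf.2 fun a =>
    calc ∫⁻ y, h a y ∂μ
        ≤ ∫⁻ y, liminf (h · y) (𝓝 a) ∂μ := lintegral_mono_ae (hlsc.mono fun _ hy => hy.le_liminf a)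
      _ ≤ liminf (fun b => ∫⁻ y, h b y ∂μ) (𝓝 a) := lintegral_liminf_le' hmeas

/-- This is Fatou's lemma for the nonnegative functions `g - h a`. -/
theorem upperSemicontinuous_integral_of_le {A Y : Type*} [TopologicalSpace A]
    [FirstCountableTopology A] [MeasurableSpace Y] {μ : Measure Y} {h : A → Y → ℝ} {g : Y → ℝ}
    (hg : Integrable g μ) (hint : ∀ a, Integrable (h a) μ) (hle : ∀ a, h a ≤ᵐ[μ] g)
    (husc : ∀ᵐ y ∂μ, UpperSemicontinuous (h · y)) :
    UpperSemicontinuous fun a => ∫ y, h a y ∂μ := by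
  have hgap (a : A) : ∫⁻ y, ENNReal.ofReal (g y - h a y) ∂μ =
      ENNReal.ofReal (∫ y, g y ∂μ - ∫ y, h a y ∂μ) := by
    rw [← integral_sub hg (hint a),
      ofReal_integral_eq_lintegral_ofReal (f := fun y => g y - h a y) (hg.sub (hint a))]
    filter_upwards [hle a] with y hy using sub_nonneg.2 hy
  have hlsc : LowerSemicontinuous fun a => ∫⁻ y, ENNReal.ofReal (g y - h a y) ∂μ :=
    lowerSemicontinuous_lintegral (fun a => (hg.sub (hint a)).aemeasurable.ennreal_ofReal)
      (husc.mono fun y hy => (Continuous.comp_upperSemicontinuous_antitone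
        (g := fun r => ENNReal.ofReal (g y - r)) (ENNReal.continuous_ofReal.comp (by fun_prop)) hy
        fun _ _ hrr' => ENNReal.ofReal_le_ofReal (sub_le_sub_left hrr' _)))
  intro a c hc
  obtain hneg | hnonneg := lt_or_ge (∫ y, g y ∂μ - c) 0
  · exact Eventually.of_forall fun b =>
      (integral_mono_ae (hint b) hg (hle b)).trans_lt (sub_neg.1 hneg)
  · have hlt : ENNReal.ofReal (∫ y, g y ∂μ - c) < ∫⁻ y, ENNReal.ofReal (g y - h a y) ∂μ := by
      rw [hgap, ENNReal.ofReal_lt_ofReal_iff_of_nonneg hnonneg]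
      exact sub_lt_sub_left hc _
    filter_upwards [hlsc a _ hlt] with b hb
    rw [gt_iff_lt, hgap, ENNReal.ofReal_lt_ofReal_iff_of_nonneg hnonneg] at hb
    exact (sub_lt_sub_iff_left _).1 hb

theorem IsUniversallyComplete.exists_measurable_argmax_integral {T A Ω : Type*} [MeasurableSpace T]
    (hT : IsUniversallyComplete T) [TopologicalSpace A] [CompactSpace A]
    [TopologicalSpace.MetrizableSpace A] [Nonempty A] [MeasurableSpace A] [BorelSpace A]
    [MeasurableSpace Ω] (κ : Kernel T Ω) [IsFiniteKernel κ] {w : A → T → Ω → ℝ}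
    (hw : Measurable fun p : (A × T) × Ω => w p.1.1 p.1.2 p.2) {C : T → ℝ}
    (hC : ∀ a t ω, |w a t ω| ≤ C t) (husc : ∀ t ω, UpperSemicontinuous (w · t ω)) :
    ∃ σ : T → A, Measurable σ ∧ ∀ t a, ∫ ω, w a t ω ∂κ t ≤ ∫ ω, w (σ t) t ω ∂κ t := by
  have hint (a : A) (t : T) : Integrable (w a t) (κ t) :=
    .of_bound (hw.comp (measurable_prodMk_left (x := (a, t)))).aestronglyMeasurable (C t)
      (ae_of_all _ (hC a t))
  have hmeas : Measurable fun p : A × T => ∫ ω, w p.1 p.2 ω ∂κ p.2 :=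
    (hw.stronglyMeasurable.integral_kernel_prod_right'
      (κ := κ.comap (Prod.snd : A × T → T) measurable_snd)).measurable
  exact hT.exists_measurable_argmax hmeas fun t => upperSemicontinuous_integral_of_le
    (integrable_const (C t)) (hint · t) (fun a => ae_of_all _ fun ω => (abs_le.1 (hC a t ω)).2)
    (ae_of_all _ (husc t))

end SemicontinuousIntegrals

section ProductMeasures

variable {ι : Type*} [DecidableEq ι] {X : ι → Type*} [∀ i, MeasurableSpace (X i)]

@[fun_prop]
theorem measurable_update_prodMk {Y : Type*} [MeasurableSpace Y] {a : Y → ∀ i, X i} {i : ι}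
    {x : Y → X i} (ha : Measurable a) (hx : Measurable x) :
    Measurable fun y => Function.update (a y) i (x y) :=
  measurable_update'.comp (ha.prodMk hx)

theorem pi_update_eq_map_prod [Fintype ι] (m : ∀ i, Measure (X i)) [∀ i, SigmaFinite (m i)] (i : ι)
    [IsProbabilityMeasure (m i)] (μ : Measure (X i)) [SigmaFinite μ] :
    Measure.pi (Function.update m i μ) =
      (μ.prod (Measure.pi m)).map fun p => Function.update p.2 i p.1 := by
  have hsigma (j : ι) : SigmaFinite (Function.update m i μ j) := by
    obtain rfl | hj := eq_or_ne j i
    · simpa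
    · rw [Function.update_of_ne hj]; infer_instance
  have hmeas : Measurable fun p : X i × (∀ j, X j) => Function.update p.2 i p.1 := by
    fun_prop
  refine Measure.pi_eq fun s hs => ?_
  have hpre : (fun p : X i × (∀ j, X j) => Function.update p.2 i p.1) ⁻¹' Set.univ.pi s =
      s i ×ˢ Set.univ.pi (Function.update s i Set.univ) := by
    ext ⟨x, a⟩
    simp only [Set.mem_preimage, Set.mem_univ_pi, Set.mem_prod]
    rw [Function.forall_update_iff a fun j y => y ∈ s j,
      Function.forall_update_iff s fun j t => a j ∈ t]
    simp
  rw [Measure.map_apply hmeas (.univ_pi hs), hpre, Measure.prod_prod, Measure.pi_pi,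
    Fintype.prod_eq_mul_prod_subtype_ne _ i, Fintype.prod_eq_mul_prod_subtype_ne _ i]
  simp only [Function.update_self, measure_univ, one_mul]
  congr 1
  refine Finset.prod_congr rfl fun j _ => ?_
  rw [Function.update_of_ne j.2, Function.update_of_ne j.2]

end ProductMeasures

section ProductKernels

variable {ι : Type*} [Fintype ι] {X Y : ι → Type*} [∀ i, MeasurableSpace (X i)]
  [∀ i, MeasurableSpace (Y i)]

/-- The product kernel from `∏ i, X i` to `∏ i, Y i`, under which the coordinates of the target
are independent given the source and the `i`-th one depends on the `i`-th source coordinate only. -/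
noncomputable def piKernel (κ : ∀ i, Kernel (X i) (Y i)) [∀ i, IsMarkovKernel (κ i)] :
    Kernel (∀ i, X i) (∀ i, Y i) where
  toFun x := Measure.pi fun i => κ i (x i)
  measurable' := by
    refine Measurable.measure_of_isPiSystem_of_isProbabilityMeasure generateFrom_pi.symm
      isPiSystem_pi ?_
    rintro _ ⟨s, hs, rfl⟩
    simp only [Measure.pi_pi]
    exact Finset.measurable_fun_prod _ fun i _ =>
      ((κ i).measurable_coe (hs i (Set.mem_univ i))).comp (measurable_pi_apply i)

theorem piKernel_apply (κ : ∀ i, Kernel (X i) (Y i)) [∀ i, IsMarkovKernel (κ i)] (x : ∀ i, X i) :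
    piKernel κ x = Measure.pi fun i => κ i (x i) := rfl

instance (κ : ∀ i, Kernel (X i) (Y i)) [∀ i, IsMarkovKernel (κ i)] :
    IsMarkovKernel (piKernel κ) :=
  ⟨fun x => by rw [piKernel_apply]; infer_instance⟩

end ProductKernels

section JoinTypes

variable {n : ℕ} {T : Fin n → Type*} (i : Fin n)

@[simp]
theorem joinTypes_self (ti : T i) (tmi : OtherTypes T i) : joinTypes i ti tmi i = ti := by
  simp [joinTypes, Equiv.piSplitAt]

theorem joinTypes_of_ne (ti : T i) (tmi : OtherTypes T i) {j : Fin n} (hj : j ≠ i) :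
    joinTypes i ti tmi j = tmi ⟨j, hj⟩ := by
  simp [joinTypes, Equiv.piSplitAt, hj]

theorem joinTypes_others (ti : T i) (tmi : OtherTypes T i) :
    (fun j : {j : Fin n // j ≠ i} => joinTypes i ti tmi j) = tmi :=
  funext fun j => joinTypes_of_ne i ti tmi j.2

theorem preimage_joinTypes_univ_pi (s : ∀ j, Set (T j)) :
    (fun p : T i × OtherTypes T i => joinTypes i p.1 p.2) ⁻¹' Set.univ.pi s =
      s i ×ˢ Set.univ.pi fun j : {j : Fin n // j ≠ i} => s j := by
  ext ⟨ti, tmi⟩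
  simp only [Set.mem_preimage, Set.mem_univ_pi, Set.mem_prod]
  refine ⟨fun h => ⟨by simpa using h i, fun j => ?_⟩, fun h j => ?_⟩
  · simpa [joinTypes_of_ne i ti tmi j.2] using h j
  · obtain rfl | hj := eq_or_ne j i
    · simpa using h.1
    · simpa [joinTypes_of_ne i ti tmi hj] using h.2 ⟨j, hj⟩

variable [∀ j, MeasurableSpace (T j)]

@[fun_prop]
theorem measurable_joinTypes {X : Type*} [MeasurableSpace X] {x : X → T i}
    {y : X → OtherTypes T i} (hx : Measurable x) (hy : Measurable y) :
    Measurable fun a => joinTypes i (x a) (y a) := by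
  refine measurable_pi_iff.2 fun j => ?_
  obtain rfl | hj := eq_or_ne j i
  · simpa using hx
  · simp only [joinTypes_of_ne i _ _ hj]
    fun_prop

theorem measurePreserving_pi_joinTypes (m : ∀ j, Measure (T j)) [∀ j, SigmaFinite (m j)] :
    MeasurePreserving (fun p : T i × OtherTypes T i => joinTypes i p.1 p.2)
      ((m i).prod (Measure.pi fun j : {j : Fin n // j ≠ i} => m j)) (Measure.pi m) := by
  have hmeas : Measurable fun p : T i × OtherTypes T i => joinTypes i p.1 p.2 := by fun_prop
  refine ⟨hmeas, (Measure.pi_eq fun s hs => ?_).symm⟩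
  rw [Measure.map_apply hmeas (.univ_pi hs), preimage_joinTypes_univ_pi, Measure.prod_prod,
    Measure.pi_pi, Fintype.prod_eq_mul_prod_subtype_ne _ i]

end JoinTypes

namespace ProductProb

variable {n : ℕ} {S : Type*} {T : Fin n → Type*} [MeasurableSpace S]
  [∀ i, MeasurableSpace (T i)] (ν : ProductProb S T) (i : Fin n)

instance : IsProbabilityMeasure ν.nature := ν.prob_nature

instance : IsProbabilityMeasure (ν.type i) := ν.prob_type i

instance : IsProbabilityMeasure (ν.others i) := by
  unfold ProductProb.others
  infer_instance

theorem measurePreserving_joinTypes :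
    MeasurePreserving (fun x : T i × S × OtherTypes T i => (x.2.1, joinTypes i x.1 x.2.2))
      ((ν.type i).prod (ν.others i)) ν.measure := by
  have hswap := Measure.measurePreserving_swap (μ := ν.type i) (ν := ν.others i)
  have hassoc : MeasurePreserving MeasurableEquiv.prodAssoc ((ν.others i).prod (ν.type i)) _ :=
    ⟨MeasurableEquiv.prodAssoc.measurable, Measure.prodAssoc_prod⟩
  have hjoin := (MeasurePreserving.id ν.nature).prod
    ((measurePreserving_pi_joinTypes i ν.type).comp Measure.measurePreserving_swap)
  exact (hjoin.comp hassoc).comp hswap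

end ProductProb

section MixedPayoff

variable {n : ℕ} {S : Type*} {T A : Fin n → Type*} [∀ i, MeasurableSpace (T i)]
  [∀ i, MeasurableSpace (A i)]

instance {X Y : Type*} [MeasurableSpace X] [MeasurableSpace Y] (γ : BehavioralStrategy X Y) :
    IsMarkovKernel γ.1 := γ.2

/-- The law of the action profile as a function of the type profile, when the players follow the
behavioral strategies `γ`. -/
noncomputable abbrev StrategyProfile.actionKernel (γ : StrategyProfile T A) :
    Kernel (∀ j, T j) (∀ j, A j) :=
  piKernel fun j => (γ j).1

theorem mixedPayoff_eq_integral_actionKernel (v : (∀ j, A j) → S → (∀ j, T j) → ℝ)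
    (γ : StrategyProfile T A) (s : S) (t : ∀ j, T j) :
    mixedPayoff v γ s t = ∫ a, v a s t ∂γ.actionKernel t := rfl

theorem StrategyProfile.actionKernel_update (γ : StrategyProfile T A) (i : Fin n)
    (δ : BehavioralStrategy (T i) (A i)) (t : ∀ j, T j) :
    StrategyProfile.actionKernel (Function.update γ i δ) t =
      ((δ.1 (t i)).prod (γ.actionKernel t)).map fun p => Function.update p.2 i p.1 := by
  simp only [piKernel_apply]
  rw [← pi_update_eq_map_prod]
  congr 1
  funext j
  exact Function.apply_update (fun j (κ : BehavioralStrategy (T j) (A j)) => κ.1 (t j)) γ i δ j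

theorem measurable_mixedPayoff [MeasurableSpace S] {v : (∀ j, A j) → S → (∀ j, T j) → ℝ}
    (hv : Measurable fun x : (∀ j, A j) × S × (∀ j, T j) => v x.1 x.2.1 x.2.2)
    (γ : StrategyProfile T A) :
    Measurable fun p : S × (∀ j, T j) => mixedPayoff v γ p.1 p.2 := by
  have hv' : Measurable fun x : (S × (∀ j, T j)) × (∀ j, A j) => v x.2 x.1.1 x.1.2 :=
    hv.comp measurable_swap
  exact (hv'.stronglyMeasurable.integral_kernel_prod_right'
    (κ := γ.actionKernel.comap Prod.snd measurable_snd)).measurable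

theorem abs_mixedPayoff_le {v : (∀ j, A j) → S → (∀ j, T j) → ℝ} {s : S} {t : ∀ j, T j} {C : ℝ}
    (hv : ∀ a, |v a s t| ≤ C) (γ : StrategyProfile T A) : |mixedPayoff v γ s t| ≤ C := by
  rw [mixedPayoff_eq_integral_actionKernel]
  simpa using norm_integral_le_of_norm_le_const (f := fun a => v a s t)
    (ae_of_all (γ.actionKernel t) hv)

end MixedPayoff

namespace IncompleteInfoGame

variable {n : ℕ} {S : Type*} {T A : Fin n → Type*} [MeasurableSpace S]
  [∀ i, MeasurableSpace (T i)] [∀ i, MeasurableSpace (A i)]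

section InterimPayoffs

variable (G : IncompleteInfoGame S T A) (i : Fin n)

instance : IsMarkovKernel (G.η i) := G.markov_η i

/-- The belief of player `i` about the payoff type, the types of the other players and the action
profile, as a function of the type of player `i`, when the players follow `γ`. -/
noncomputable def outcome (γ : StrategyProfile T A) :
    Kernel (T i) ((S × OtherTypes T i) × (∀ j, A j)) :=
  G.η i ⊗ₖ γ.actionKernel.comap
    (fun x : T i × S × OtherTypes T i => joinTypes i x.1 x.2.2) (by fun_prop)

instance (γ : StrategyProfile T A) : IsMarkovKernel (G.outcome i γ) := by
  unfold outcome
  infer_instance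

theorem lintegral_outcome (γ : StrategyProfile T A) (ti : T i)
    {g : (S × OtherTypes T i) × (∀ j, A j) → ℝ≥0∞} (hg : Measurable g) :
    ∫⁻ q, g q ∂G.outcome i γ ti =
      ∫⁻ p, ∫⁻ a, g (p, a) ∂γ.actionKernel (joinTypes i ti p.2) ∂G.η i ti :=
  Kernel.lintegral_compProd _ _ _ hg

theorem outcome_update (γ : StrategyProfile T A) (δ : BehavioralStrategy (T i) (A i)) (ti : T i) :
    G.outcome i (Function.update γ i δ) ti =
      ((δ.1 ti).prod (G.outcome i γ ti)).map fun q => (q.2.1, Function.update q.2.2 i q.1) := by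
  refine Measure.ext_of_lintegral _ fun g hg => ?_
  let K : Kernel ((S × OtherTypes T i) × A i) (∀ j, A j) :=
    γ.actionKernel.comap (fun y => joinTypes i ti y.1.2) (by fun_prop)
  have hinner : Measurable fun y : (S × OtherTypes T i) × A i =>
      ∫⁻ a, g (y.1, Function.update a i y.2) ∂K y := by
    have hg' : Measurable fun z : ((S × OtherTypes T i) × A i) × (∀ j, A j) =>
        g (z.1.1, Function.update z.2 i z.1.2) := by fun_prop
    exact hg'.lintegral_kernel_prod_right'
  calc ∫⁻ q, g q ∂G.outcome i (Function.update γ i δ) ti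
      = ∫⁻ p, ∫⁻ x, ∫⁻ a, g (p, Function.update a i x) ∂K (p, x) ∂δ.1 ti ∂G.η i ti := by
        rw [lintegral_outcome _ _ _ _ hg]
        refine lintegral_congr fun p => ?_
        rw [StrategyProfile.actionKernel_update, joinTypes_self,
          lintegral_map (by fun_prop) (by fun_prop), lintegral_prod _ (by fun_prop)]
        rfl
    _ = ∫⁻ x, ∫⁻ p, ∫⁻ a, g (p, Function.update a i x) ∂K (p, x) ∂G.η i ti ∂δ.1 ti :=
        lintegral_lintegral_swap hinner.aemeasurable
    _ = ∫⁻ x, ∫⁻ q, g (q.1, Function.update q.2 i x) ∂G.outcome i γ ti ∂δ.1 ti :=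
        lintegral_congr fun x => (G.lintegral_outcome i γ ti
          (g := fun q => g (q.1, Function.update q.2 i x)) (by fun_prop)).symm
    _ = _ := by rw [lintegral_map hg (by fun_prop), lintegral_prod _ (by fun_prop)]

/-- The payoff of player `i` of type `ti` from playing `x` instead of their component of the action
profile. -/
def deviationPayoff (x : A i) (ti : T i) (q : (S × OtherTypes T i) × (∀ j, A j)) : ℝ :=
  G.u i (Function.update q.2 i x) q.1.1 (joinTypes i ti q.1.2)

theorem measurable_deviationPayoff :
    Measurable fun p : (A i × T i) × (S × OtherTypes T i) × (∀ j, A j) =>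
      G.deviationPayoff i p.1.1 p.1.2 p.2 := by
  have hprofile : Measurable fun p : (A i × T i) × (S × OtherTypes T i) × (∀ j, A j) =>
      (Function.update p.2.2 i p.1.1, p.2.1.1, joinTypes i p.1.2 p.2.1.2) := by fun_prop
  exact (G.measurable_u i).comp hprofile

theorem measurable_mixedPayoff_joinTypes (γ : StrategyProfile T A) :
    Measurable fun x : T i × S × OtherTypes T i =>
      mixedPayoff (G.u i) γ x.2.1 (joinTypes i x.1 x.2.2) := by
  have hprofile : Measurable fun x : T i × S × OtherTypes T i =>
      (x.2.1, joinTypes i x.1 x.2.2) := by fun_prop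
  exact (measurable_mixedPayoff (G.measurable_u i) γ).comp hprofile

theorem measurable_expectedPayoff (γ : StrategyProfile T A) :
    Measurable (G.expectedPayoff i γ) :=
  ((G.measurable_mixedPayoff_joinTypes i γ).stronglyMeasurable.integral_kernel_prod_right'
    (κ := G.η i)).measurable

theorem measurable_weightedPayoff {f : ∀ i, T i × S × OtherTypes T i → ℝ≥0}
    (hf : Measurable (f i)) :
    Measurable fun p : (∀ j, A j) × S × (∀ j, T j) => G.weightedPayoff f i p.1 p.2.1 p.2.2 := by
  have hprofile : Measurable fun p : (∀ j, A j) × S × (∀ j, T j) =>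
      (p.2.2 i, p.2.1, fun j : {j : Fin n // j ≠ i} => p.2.2 j) := by fun_prop
  exact (G.measurable_u i).mul (hf.comp hprofile).coe_nnreal_real

end InterimPayoffs

section BoundedPayoffs

variable {G : IncompleteInfoGame S T A} {ubar : ∀ i, T i → ℝ≥0} (i : Fin n)
  (γ : StrategyProfile T A)

theorem PayoffBound.abs_u_joinTypes_le (hubar : G.PayoffBound ubar) (a : ∀ j, A j) (ti : T i)
    (p : S × OtherTypes T i) : |G.u i a p.1 (joinTypes i ti p.2)| ≤ ubar i ti := by
  simpa using (hubar i).2 a p.1 (joinTypes i ti p.2)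

theorem PayoffBound.expectedPayoff_eq_integral_outcome (hubar : G.PayoffBound ubar) (ti : T i) :
    G.expectedPayoff i γ ti =
      ∫ q, G.u i q.2 q.1.1 (joinTypes i ti q.1.2) ∂G.outcome i γ ti := by
  have hprofile : Measurable fun q : (S × OtherTypes T i) × (∀ j, A j) =>
      (q.2, q.1.1, joinTypes i ti q.1.2) := by fun_prop
  have hint : Integrable (fun q => G.u i q.2 q.1.1 (joinTypes i ti q.1.2)) (G.outcome i γ ti) :=
    .of_bound ((G.measurable_u i).comp hprofile).aestronglyMeasurable (ubar i ti)
      (ae_of_all _ fun q => hubar.abs_u_joinTypes_le i q.2 ti q.1)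
  exact (integral_compProd hint).symm

theorem PayoffBound.integrable_deviationPayoff (hubar : G.PayoffBound ubar) (ti : T i)
    (μ : Measure (A i)) [IsFiniteMeasure μ] :
    Integrable (fun p : A i × (S × OtherTypes T i) × (∀ j, A j) => G.deviationPayoff i p.1 ti p.2)
      (μ.prod (G.outcome i γ ti)) := by
  have hsection : Measurable fun p : A i × (S × OtherTypes T i) × (∀ j, A j) =>
      ((p.1, ti), p.2) := by fun_prop
  exact .of_bound ((G.measurable_deviationPayoff i).comp hsection).aestronglyMeasurable (ubar i ti)
    (ae_of_all _ fun p => hubar.abs_u_joinTypes_le i _ ti p.2.1)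

theorem PayoffBound.expectedPayoff_update (hubar : G.PayoffBound ubar)
    (δ : BehavioralStrategy (T i) (A i)) (ti : T i) :
    G.expectedPayoff i (Function.update γ i δ) ti =
      ∫ x, ∫ q, G.deviationPayoff i x ti q ∂G.outcome i γ ti ∂δ.1 ti := by
  have hprofile : Measurable fun q : (S × OtherTypes T i) × (∀ j, A j) =>
      (q.2, q.1.1, joinTypes i ti q.1.2) := by fun_prop
  have hmeas : Measurable fun q : (S × OtherTypes T i) × (∀ j, A j) =>
      G.u i q.2 q.1.1 (joinTypes i ti q.1.2) := (G.measurable_u i).comp hprofile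
  rw [hubar.expectedPayoff_eq_integral_outcome, outcome_update,
    integral_map (by fun_prop) hmeas.aestronglyMeasurable]
  exact integral_prod _ (hubar.integrable_deviationPayoff i γ ti _)

theorem PayoffBound.integrable_mixedPayoff (hubar : G.PayoffBound ubar) {μ : Measure (T i)}
    [SFinite μ] (hμ : ∫⁻ ti, (ubar i ti : ℝ≥0∞) ∂μ < ∞) :
    Integrable (fun x => mixedPayoff (G.u i) γ x.2.1 (joinTypes i x.1 x.2.2)) (μ ⊗ₘ G.η i) := by
  have hbound : Integrable (fun ti => (ubar i ti : ℝ)) ((μ ⊗ₘ G.η i).map Prod.fst) := by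
    rw [← Measure.fst, Measure.fst_compProd]
    exact ⟨(hubar i).1.coe_nnreal_real.aestronglyMeasurable, by simpa [HasFiniteIntegral] using hμ⟩
  exact (hbound.comp_measurable measurable_fst).mono'
    (G.measurable_mixedPayoff_joinTypes i γ).aestronglyMeasurable
    (ae_of_all _ fun x => abs_mixedPayoff_le (hubar.abs_u_joinTypes_le i · x.1 x.2) γ)

theorem PayoffBound.integrable_expectedPayoff (hubar : G.PayoffBound ubar) {μ : Measure (T i)}
    [SFinite μ] (hμ : ∫⁻ ti, (ubar i ti : ℝ≥0∞) ∂μ < ∞) : Integrable (G.expectedPayoff i γ) μ :=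
  Integrable.integral_compProd (κ := Kernel.const Unit μ)
    (η := Kernel.prodMkLeft Unit (G.η i)) (a := ()) (hubar.integrable_mixedPayoff i γ hμ)

theorem PayoffBound.exAntePayoff_eq_integral_expectedPayoff (hubar : G.PayoffBound ubar)
    {ν : ProductProb S T} (hν : ∫⁻ ti, (ubar i ti : ℝ≥0∞) ∂ν.type i < ∞)
    {f : ∀ i, T i × S × OtherTypes T i → ℝ≥0} (hf : G.IsBeliefDensity ν f) :
    G.exAntePayoff ν f i γ = ∫ ti, G.expectedPayoff i γ ti ∂ν.type i := by
  have hmeas := measurable_mixedPayoff (G.measurable_weightedPayoff i (hf i).1) γ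
  have hjoin := ν.measurePreserving_joinTypes i
  have hweight (s : S) (t : ∀ j, T j) : mixedPayoff (G.weightedPayoff f i) γ s t =
      mixedPayoff (G.u i) γ s t * f i (t i, s, fun j => t j) := integral_mul_const _ _
  calc G.exAntePayoff ν f i γ
      = ∫ x, f i x • mixedPayoff (G.u i) γ x.2.1 (joinTypes i x.1 x.2.2)
          ∂(ν.type i).prod (ν.others i) := by
        rw [exAntePayoff, ← hjoin.map_eq,
          integral_map hjoin.measurable.aemeasurable hmeas.aestronglyMeasurable]
        simp only [hweight, joinTypes_self, joinTypes_others, NNReal.smul_def, smul_eq_mul]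
        simp only [mul_comm (mixedPayoff _ _ _ _)]
    _ = ∫ x, mixedPayoff (G.u i) γ x.2.1 (joinTypes i x.1 x.2.2) ∂(ν.type i ⊗ₘ G.η i) := by
        rw [(hf i).2, integral_withDensity_eq_integral_smul (hf i).1]
    _ = ∫ ti, G.expectedPayoff i γ ti ∂ν.type i :=
        Measure.integral_compProd (hubar.integrable_mixedPayoff i γ hν)

end BoundedPayoffs

section BestReplies

variable {G : IncompleteInfoGame S T A} {ubar : ∀ i, T i → ℝ≥0} {i : Fin n}

/-- `σ` is a best reply of player `i` at type `ti` to the strategies `γ j` with `j ≠ i`. -/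
def IsBestReply (G : IncompleteInfoGame S T A) (i : Fin n) (γ : StrategyProfile T A)
    (σ : BehavioralStrategy (T i) (A i)) (ti : T i) : Prop :=
  ∀ δ : BehavioralStrategy (T i) (A i),
    G.expectedPayoff i (Function.update γ i δ) ti ≤ G.expectedPayoff i (Function.update γ i σ) ti

theorem mem_BE_iff {γ : StrategyProfile T A} :
    γ ∈ G.BE ↔ ∀ i, ∀ ti : T i, G.IsBestReply i γ (γ i) ti := by
  simp only [BE, IsBestReply, Function.update_eq_self, Set.mem_ofPred_eq]

theorem IsBestReply.isBestReply_iff {γ : StrategyProfile T A}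
    {σ δ : BehavioralStrategy (T i) (A i)} {ti : T i} (hσ : G.IsBestReply i γ σ ti) :
    G.IsBestReply i γ δ ti ↔ G.expectedPayoff i (Function.update γ i σ) ti ≤
      G.expectedPayoff i (Function.update γ i δ) ti :=
  ⟨fun hδ => hδ σ, fun hle δ' => (hσ δ').trans hle⟩

/-- Against fixed strategies of the others, the payoff is linear in the player's own mixed action,
so a measurable selection of optimal pure actions is a best reply at every type. -/
theorem UpperSemicontinuousPayoffs.exists_forall_isBestReply [∀ i, TopologicalSpace (A i)]
    [CompactSpace (A i)] [TopologicalSpace.MetrizableSpace (A i)] [BorelSpace (A i)]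
    (husc : G.UpperSemicontinuousPayoffs) (hubar : G.PayoffBound ubar)
    (hT : IsUniversallyComplete (T i)) (γ : StrategyProfile T A) :
    ∃ σ, ∀ ti, G.IsBestReply i γ σ ti := by
  obtain hempty | ⟨⟨ti₀⟩⟩ := isEmpty_or_nonempty (T i)
  · exact ⟨γ i, isEmptyElim⟩
  have : Nonempty (A i) := Measure.nonempty_of_neZero ((γ i).1 ti₀)
  obtain ⟨s, hs, hmax⟩ := hT.exists_measurable_argmax_integral (G.outcome i γ)
    (G.measurable_deviationPayoff i) (C := fun ti => ubar i ti)
    (fun x ti q => hubar.abs_u_joinTypes_le i _ ti q.1)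
    (fun ti q => husc i q.2 q.1.1 (joinTypes i ti q.1.2))
  refine ⟨⟨Kernel.deterministic s hs, inferInstance⟩, fun ti δ => ?_⟩
  rw [hubar.expectedPayoff_update, hubar.expectedPayoff_update, Kernel.deterministic_apply,
    integral_dirac]
  calc ∫ x, ∫ q, G.deviationPayoff i x ti q ∂G.outcome i γ ti ∂δ.1 ti
      ≤ ∫ _, ∫ q, G.deviationPayoff i (s ti) ti q ∂G.outcome i γ ti ∂δ.1 ti :=
        integral_mono (hubar.integrable_deviationPayoff i γ ti _).integral_prod_left
          (integrable_const _) (hmax ti)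
    _ = ∫ q, G.deviationPayoff i (s ti) ti q ∂G.outcome i γ ti := by simp

theorem measurableSet_setOf_isBestReply {γ : StrategyProfile T A}
    {σ : BehavioralStrategy (T i) (A i)} (hσ : ∀ ti, G.IsBestReply i γ σ ti)
    (δ : BehavioralStrategy (T i) (A i)) : MeasurableSet {ti | G.IsBestReply i γ δ ti} := by
  simp only [(hσ _).isBestReply_iff]
  exact measurableSet_le (G.measurable_expectedPayoff i _) (G.measurable_expectedPayoff i _)

theorem expectedPayoff_congr {ν : ProductProb S T} {ti : T i} (hη : G.η i ti ≪ ν.others i)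
    {γ γ' : StrategyProfile T A} (hi : (γ i).1 ti = (γ' i).1 ti)
    (h : ∀ j ≠ i, ∀ᵐ tj ∂ν.type j, (γ j).1 tj = (γ' j).1 tj) :
    G.expectedPayoff i γ ti = G.expectedPayoff i γ' ti := by
  have hothers : ∀ᵐ p ∂ν.others i, ∀ j : {j : Fin n // j ≠ i},
      (γ j).1 (p.2 j) = (γ' j).1 (p.2 j) :=
    ae_all_iff.2 fun j => ((Measure.quasiMeasurePreserving_eval
      (fun j : {j : Fin n // j ≠ i} => ν.type j) j).comp
        Measure.quasiMeasurePreserving_snd).ae (h j j.2)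
  refine integral_congr_ae ((Filter.Eventually.filter_mono hη.ae_le hothers).mono fun p hp => ?_)
  have hall (j : Fin n) : (γ j).1 (joinTypes i ti p.2 j) = (γ' j).1 (joinTypes i ti p.2 j) := by
    obtain rfl | hj := eq_or_ne j i
    · simpa using hi
    · simpa only [joinTypes_of_ne i ti p.2 hj] using hp ⟨j, hj⟩
  simp only [mixedPayoff, hall]

theorem IsBestReply.congr {ν : ProductProb S T} {ti : T i} (hη : G.η i ti ≪ ν.others i)
    {γ γ' : StrategyProfile T A} (hγ : StrategyEquiv ν γ γ')
    {σ σ' : BehavioralStrategy (T i) (A i)} (hσ : G.IsBestReply i γ σ ti)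
    (hti : σ.1 ti = σ'.1 ti) : G.IsBestReply i γ' σ' ti := by
  have hupdate {δ δ' : BehavioralStrategy (T i) (A i)} (hδ : δ.1 ti = δ'.1 ti) :
      G.expectedPayoff i (Function.update γ i δ) ti =
        G.expectedPayoff i (Function.update γ' i δ') ti :=
    expectedPayoff_congr hη (by simpa using hδ) fun j hj => by simpa [hj] using hγ j
  exact fun δ => hupdate (δ := δ) rfl ▸ hupdate hti ▸ hσ δ

end BestReplies

section Equilibria

variable {G : IncompleteInfoGame S T A} {ubar : ∀ i, T i → ℝ≥0} {ν : ProductProb S T}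

theorem mem_BNE_iff_ae_isBestReply (hubar : G.PayoffBound ubar)
    (hν : ∀ i, ∫⁻ ti, (ubar i ti : ℝ≥0∞) ∂ν.type i < ∞)
    {f : ∀ i, T i × S × OtherTypes T i → ℝ≥0} (hf : G.IsBeliefDensity ν f)
    {γ : StrategyProfile T A} (hbest : ∀ i, ∃ σ, ∀ ti, G.IsBestReply i γ σ ti) :
    γ ∈ G.BNE ν f ↔ ∀ i, ∀ᵐ ti ∂ν.type i, G.IsBestReply i γ (γ i) ti := by
  have hint (i : Fin n) (γ' : StrategyProfile T A) := hubar.integrable_expectedPayoff i γ' (hν i)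
  have hmean (i : Fin n) (γ' : StrategyProfile T A) :=
    hubar.exAntePayoff_eq_integral_expectedPayoff i γ' (hν i) hf
  simp only [BNE, Set.mem_ofPred_eq, hmean]
  refine forall_congr' fun i => ⟨fun hγ => ?_, fun hγ δ => ?_⟩
  · obtain ⟨σ, hσ⟩ := hbest i
    have hle : G.expectedPayoff i γ ≤ G.expectedPayoff i (Function.update γ i σ) := fun ti => by
      simpa using hσ ti (γ i)
    have heq := (integral_eq_iff_of_ae_le (hint i _) (hint i _) (ae_of_all _ hle)).1
      ((integral_mono (hint i _) (hint i _) hle).antisymm (hγ σ))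
    filter_upwards [heq] with ti hti
    simpa [(hσ ti).isBestReply_iff] using hti.ge
  · refine integral_mono_ae (hint i _) (hint i _) (hγ.mono fun ti hti => ?_)
    simpa using hti δ

theorem mem_BEClosure_iff_ae_isBestReply (hη : ∀ i, ∀ ti : T i, G.η i ti ≪ ν.others i)
    {γ : StrategyProfile T A} (hbest : ∀ i, ∃ σ, ∀ ti, G.IsBestReply i γ σ ti) :
    γ ∈ G.BEClosure ν ↔ ∀ i, ∀ᵐ ti ∂ν.type i, G.IsBestReply i γ (γ i) ti := by
  classical
  simp only [BEClosure, Set.mem_ofPred_eq, mem_BE_iff]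
  refine ⟨fun ⟨γ', hγ', hequiv⟩ i => ?_, fun hγ => ?_⟩
  · have hequiv' : StrategyEquiv ν γ' γ := fun j => (hequiv j).mono fun _ => Eq.symm
    exact (hequiv' i).mono fun ti hti => (hγ' i ti).congr (hη i ti) hequiv' hti
  · choose σ hσ using hbest
    let γ' : StrategyProfile T A := fun i =>
      ⟨Kernel.piecewise (measurableSet_setOf_isBestReply (hσ i) (γ i)) (γ i).1 (σ i).1,
        inferInstance⟩
    have hequiv : StrategyEquiv ν γ γ' := fun i => (hγ i).mono fun ti hti => (if_pos hti).symm
    refine ⟨γ', fun i ti => ?_, hequiv⟩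
    by_cases hti : G.IsBestReply i γ (γ i) ti
    · exact hti.congr (hη i ti) hequiv (if_pos hti).symm
    · exact (hσ i ti).congr (hη i ti) hequiv (if_neg hti).symm

end Equilibria

end IncompleteInfoGame

theorem mainTheorem7 {n : ℕ} {S : Type*} {T A : Fin n → Type*}
    [MeasurableSpace S] [∀ i, MeasurableSpace (T i)]
    [∀ i, TopologicalSpace (A i)] [∀ i, CompactSpace (A i)]
    [∀ i, TopologicalSpace.MetrizableSpace (A i)]
    [∀ i, MeasurableSpace (A i)] [∀ i, BorelSpace (A i)]
    (hT : ∀ i, IsUniversallyComplete (T i))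
    (G : IncompleteInfoGame S T A)
    (ubar : ∀ i, T i → ℝ≥0) (hubar : G.PayoffBound ubar)
    (husc : G.UpperSemicontinuousPayoffs)
    (ν : ProductProb S T) (hν : ν ∈ G.M ubar)
    (f : ∀ i, T i × S × OtherTypes T i → ℝ≥0) (hf : G.IsBeliefDensity ν f) :
    G.BNE ν f = G.BEClosure ν := by
  ext γ
  have hbest (i : Fin n) : ∃ σ, ∀ ti, G.IsBestReply i γ σ ti :=
    husc.exists_forall_isBestReply hubar (hT i) γ
  rw [IncompleteInfoGame.mem_BNE_iff_ae_isBestReply hubar hν.2 hf hbest,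
    IncompleteInfoGame.mem_BEClosure_iff_ae_isBestReply hν.1 hbest]
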